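/- Let $(\mathbf V,\in,\mathrm{st})$ be a universe (model) of Bounded Set Theory $\mathrm{BST}$, that is, of $\mathrm{ZFC}$ (with Separation and Replacement for $\in$-formulas) together with the following axioms. Here quantifiers $\forall^{\mathrm{st}},\exists^{\mathrm{st}}$ range over standard sets, and $\forall^{\mathrm{st\,fin}}$ ranges over standard finite sets. * Boundedness: $\forall x\,\exists^{\mathrm{st}}y\,(x\in y)$. * Transfer: $\forall^{\mathrm{st}}x\,\phi(x)\to\forall x\,\phi(x)$ for $\in$-formulas $\phi$ with standard parameters. * Standardization: $\forall A\,\exists^{\mathrm{st}}S\,\forall^{\mathrm{st}}x\,(x\in S\leftrightarrow x\in A\wedge\phi(x))$ for $\mathrm{st}$-$\in$-formulas $\phi$ with arbitrary parameters. * Bounded Idealization: $\forall^{\mathrm{st\,fin}}a\subseteq A\,\exists y\,\forall x\in a\,\phi(x,y)\leftrightarrow\exists y\,\forall^{\mathrm{st}}x\in A\,\phi(x,y)$ for standard $A$ and $\in$-formulas $\phi$ with arbitrary parameters. Let $I$ be a standard set and $w\in I$. A set $x$ is called $w$-standard, written $\mathrm{st}_w(x)$, if $x=f(w)$ for some standard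 function $f$ with domain $I$. For an $\in$-formula $\phi$, let $\phi^{\mathrm{st}_w}$ be the formula obtained from $\phi$ by relativizing all quantifiers to $\mathrm{st}_w$. There is a unique standard set $U_w$ such that, for all standard $X$, $$X\in U_w\iff X\subseteq I\ \text{ and }\ w\in X .$$ For every $r\ge 0$, every $\in$-formula $\phi(v_1,\dots,v_r)$ and all standard functions $f_1,\dots,f_r$ with domain $I$, $$\phi^{\mathrm{st}_w}(f_1(w),\dots,f_r(w))\iff\{\,i\in I : \phi(f_1(i),\dots,f_r(i))\,\}\in U_w .$$ -/

import Mathlib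

namespace BST

/-- The only symbol of the `∈`-language: the binary relation `∈`. -/
inductive MemRel : ℕ → Type
  | mem : MemRel 2

/-- The symbols of the `st`-`∈`-language: the binary relation `∈` and the unary predicate `st`. -/
inductive StMemRel : ℕ → Type
  | mem : StMemRel 2
  | st : StMemRel 1

/-- The `∈`-language. -/
def memLang : FirstOrder.Language.{0, 0} := ⟨fun _ => Empty, MemRel⟩

/-- The `st`-`∈`-language. -/
def stMemLang : FirstOrder.Language.{0, 0} := ⟨fun _ => Empty, StMemRel⟩

/-- A universe of objects with a membership relation and a standardness predicate. -/
class StMem (V : Type*) where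
  mem : V → V → Prop
  st : V → Prop

infix:50 " ∊ " => StMem.mem

/-- `x` is standard. -/
abbrev St {V : Type*} [StMem V] (x : V) : Prop := StMem.st x

instance memStructure (V : Type*) [StMem V] : memLang.Structure V where
  funMap := fun c _ => Empty.elim c
  RelMap := fun R xs =>
    match R, xs with
    | MemRel.mem, xs => xs 0 ∊ xs 1

instance stMemStructure (V : Type*) [StMem V] : stMemLang.Structure V where
  funMap := fun c _ => Empty.elim c
  RelMap := fun R xs =>
    match R, xs with
    | StMemRel.mem, xs => xs 0 ∊ xs 1
    | StMemRel.st, xs => St (xs 0)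

section SetTheory

variable {V : Type*} [StMem V]

/-- `x ⊆ y`. -/
def Sub (x y : V) : Prop := ∀ z, z ∊ x → z ∊ y

/-- `x = ∅`. -/
def IsEmptySet (x : V) : Prop := ∀ z, ¬ z ∊ x

/-- `s = y ∪ {y}`. -/
def IsSucc (s y : V) : Prop := ∀ z, z ∊ s ↔ z ∊ y ∨ z = y

/-- `x` contains `∅` and is closed under `y ↦ y ∪ {y}`. -/
def IsInductive (x : V) : Prop :=
  (∃ e, IsEmptySet e ∧ e ∊ x) ∧ ∀ y, y ∊ x → ∃ s, IsSucc s y ∧ s ∊ x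

/-- `z` is the Kuratowski pair `⟨a, b⟩ = {{a}, {a, b}}`. -/
def IsPair (z a b : V) : Prop :=
  ∀ u, u ∊ z ↔ (∀ v, v ∊ u ↔ v = a) ∨ (∀ v, v ∊ u ↔ v = a ∨ v = b)

/-- `⟨i, x⟩ ∈ f`; for a function `f` this is `f(i) = x`. -/
def Val (f i x : V) : Prop := ∃ z, z ∊ f ∧ IsPair z i x

/-- `f` is a function with domain `I`. -/
def IsFunOn (f I : V) : Prop :=
  (∀ z, z ∊ f → ∃ i, i ∊ I ∧ ∃ x, IsPair z i x) ∧ ∀ i, i ∊ I → ∃! x, Val f i x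

/-- `n` is a natural number (a finite von Neumann ordinal of the universe `V`). -/
def IsNat (n : V) : Prop := ∀ x, IsInductive x → n ∊ x

/-- `a` is finite in the sense of `V`: some function in `V` is a bijection from a natural number
of `V` onto `a`. -/
def IsFin (a : V) : Prop :=
  ∃ n f, IsNat n ∧ IsFunOn f n ∧
    (∀ i j x, Val f i x → Val f j x → i = j) ∧ ∀ x, x ∊ a ↔ ∃ i, Val f i x

end SetTheory

/-- The universe `V` with its relation `∈` satisfies `ZFC`. The formulas in the schemata of
Separation and Replacement are `∈`-formulas, with parameters `p`. -/
structure ModelsZFC (V : Type*) [StMem V] : Prop where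
  extensionality : ∀ x y : V, (∀ z, z ∊ x ↔ z ∊ y) → x = y
  foundation : ∀ x : V, (∃ y, y ∊ x) → ∃ y, y ∊ x ∧ ∀ z, z ∊ x → ¬ z ∊ y
  pairing : ∀ x y : V, ∃ z, ∀ u, u ∊ z ↔ u = x ∨ u = y
  union : ∀ x : V, ∃ z, ∀ u, u ∊ z ↔ ∃ y, y ∊ x ∧ u ∊ y
  powerset : ∀ x : V, ∃ z, ∀ u, u ∊ z ↔ Sub u x
  infinity : ∃ x : V, IsInductive x
  separation : ∀ (n : ℕ) (φ : memLang.BoundedFormula (Fin n) 1) (p : Fin n → V) (A : V),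
    ∃ B : V, ∀ x, x ∊ B ↔ x ∊ A ∧ φ.Realize p ![x]
  replacement : ∀ (n : ℕ) (φ : memLang.BoundedFormula (Fin n) 2) (p : Fin n → V),
    (∀ x y z, φ.Realize p ![x, y] → φ.Realize p ![x, z] → y = z) →
    ∀ A : V, ∃ B : V, ∀ y, y ∊ B ↔ ∃ x, x ∊ A ∧ φ.Realize p ![x, y]
  choice : ∀ A : V, (∀ x, x ∊ A → ∃ y, y ∊ x) →
    (∀ x y, x ∊ A → y ∊ A → x ≠ y → ¬ ∃ z, z ∊ x ∧ z ∊ y) →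
    ∃ C, ∀ x, x ∊ A → ∃! y, y ∊ x ∧ y ∊ C

/-- `(V, ∈, st)` is a model of Bounded Set Theory: `ZFC` for `∈`-formulas, together with
Boundedness, Transfer, Standardization and Bounded Idealization. -/
structure ModelsBST (V : Type*) [StMem V] : Prop extends ModelsZFC V where
  boundedness : ∀ x : V, ∃ y, St y ∧ x ∊ y
  transfer : ∀ (n : ℕ) (φ : memLang.BoundedFormula (Fin n) 1) (p : Fin n → V),
    (∀ k, St (p k)) → (∀ x, St x → φ.Realize p ![x]) → ∀ x, φ.Realize p ![x]
  standardization : ∀ (n : ℕ) (φ : stMemLang.BoundedFormula (Fin n) 1) (p : Fin n → V) (A : V),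
    ∃ S, St S ∧ ∀ x, St x → (x ∊ S ↔ x ∊ A ∧ φ.Realize p ![x])
  boundedIdealization : ∀ (n : ℕ) (φ : memLang.BoundedFormula (Fin n) 2) (p : Fin n → V) (A : V),
    St A →
    ((∀ a, St a → IsFin a → Sub a A → ∃ y, ∀ x, x ∊ a → φ.Realize p ![x, y]) ↔
      ∃ y, ∀ x, St x → x ∊ A → φ.Realize p ![x, y])

/-- Truth of the formula `φ^P` obtained from the formula `φ` by relativizing all quantifiers to
the class `P`. -/
def RelRealize {L : FirstOrder.Language} {V α : Type*} [L.Structure V] (P : V → Prop) :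
    ∀ {n : ℕ}, L.BoundedFormula α n → (α → V) → (Fin n → V) → Prop
  | _, .falsum, _, _ => False
  | _, .equal t₁ t₂, v, xs => t₁.realize (Sum.elim v xs) = t₂.realize (Sum.elim v xs)
  | _, .rel R ts, v, xs =>
      FirstOrder.Language.Structure.RelMap R fun i => (ts i).realize (Sum.elim v xs)
  | _, .imp φ ψ, v, xs => RelRealize P φ v xs → RelRealize P ψ v xs
  | _, .all φ, v, xs => ∀ x, P x → RelRealize P φ v (Fin.snoc xs x)

section Subuniverse

variable {V : Type*} [StMem V]

/-- `x` is `w`-standard: `x = f(w)` for some standard function `f` with domain `I`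
(where `I` is a standard set with `w ∈ I`). -/
def StW (w I x : V) : Prop := ∃ f, St f ∧ IsFunOn f I ∧ Val f w x

/-- `U = U_w`: the standard set `U` whose standard elements are exactly the standard subsets `X`
of `I` with `w ∈ X`. -/
def IsUW (w I U : V) : Prop := St U ∧ ∀ X, St X → (X ∊ U ↔ Sub X I ∧ w ∊ X)

end Subuniverse

end BST

/-! Both sides of the equivalence say that φ(f₁(w), …, f_r(w)) is true in `V`. The set X = {i ∈ I :
φ(f₁(i), …, f_r(i))} has a standard definition, so Transfer makes it standard, and X ∈ U then means
w ∈ X. For the relativized side, the w-standard sets are an elementary submodel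
(`ModelsBST.relRealize_stW_iff`). If Q(w, x) is solvable, with Q definable from standard parameters,
Boundedness puts a solution in a standard A. Choice gives a function g on I selecting, for each i, a
solution of Q(i, ·) in A if there is one. By Transfer g may be taken standard, and g(w) is a
w-standard solution (`ModelsBST.exists_stW`). `Dfn` tracks definability together with the parameters
allowed: all sets for Separation, standard ones for Transfer. -/

open FirstOrder Language

namespace BST

/-! ### Closure properties of definability with parameters -/

section Definability

variable {V : Type*}

/-- `t` is a projection or a constant from `C`. -/
def IsVar (C : Set V) {α : Type} (t : (α → V) → V) : Prop :=
  ∃ a : C ⊕ α, ∀ v, Sum.elim Subtype.val v a = t v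

variable {C : Set V} {α β : Type} {P Q : (α → V) → Prop} {s t u : (α → V) → V}

theorem IsVar.proj (C : Set V) (a : α) : IsVar C fun v : α → V => v a :=
  ⟨.inr a, fun _ => rfl⟩

theorem IsVar.const {c : V} (hc : c ∈ C) : IsVar C fun _ : α → V => c :=
  ⟨.inl ⟨c, hc⟩, fun _ => rfl⟩

variable [StMem V]

/-- `P` is definable by an `∈`-formula with parameters from `C`. -/
def Dfn (C : Set V) {α : Type} (P : (α → V) → Prop) : Prop :=
  ∃ φ : memLang.Formula (C ⊕ α), ∀ v, φ.Realize (Sum.elim Subtype.val v) ↔ P v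

theorem Dfn.congr (h : Dfn C P) (hPQ : ∀ v, P v ↔ Q v) : Dfn C Q := by
  obtain ⟨φ, h⟩ := h
  exact ⟨φ, fun v => (h v).trans (hPQ v)⟩

theorem Dfn.imp (hP : Dfn C P) (hQ : Dfn C Q) : Dfn C fun v => P v → Q v := by
  obtain ⟨φ, h⟩ := hP
  obtain ⟨ψ, h'⟩ := hQ
  exact ⟨BoundedFormula.imp φ ψ, fun v => imp_congr (h v) (h' v)⟩

theorem Dfn.false : Dfn C fun _ : α → V => False := ⟨⊥, fun _ => Iff.rfl⟩

theorem Dfn.not (hP : Dfn C P) : Dfn C fun v => ¬ P v := hP.imp .false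

theorem Dfn.or (hP : Dfn C P) (hQ : Dfn C Q) : Dfn C fun v => P v ∨ Q v :=
  (hP.not.imp hQ).congr fun v => by tauto

theorem Dfn.and (hP : Dfn C P) (hQ : Dfn C Q) : Dfn C fun v => P v ∧ Q v :=
  ((hP.imp hQ.not).not).congr fun v => by tauto

theorem Dfn.iff (hP : Dfn C P) (hQ : Dfn C Q) : Dfn C fun v => (P v ↔ Q v) :=
  ((hP.imp hQ).and (hQ.imp hP)).congr fun v => by tauto

theorem Dfn.mem (hs : IsVar C s) (ht : IsVar C t) : Dfn C fun v => s v ∊ t v := by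
  obtain ⟨a, ha⟩ := hs
  obtain ⟨b, hb⟩ := ht
  refine ⟨BoundedFormula.rel (L := memLang) MemRel.mem ![Term.var (.inl a), Term.var (.inl b)],
    fun v => ?_⟩
  change _ ↔ s v ∊ t v
  rw [← ha, ← hb]
  rfl

theorem Dfn.eq (hs : IsVar C s) (ht : IsVar C t) : Dfn C fun v => s v = t v := by
  obtain ⟨a, ha⟩ := hs
  obtain ⟨b, hb⟩ := ht
  refine ⟨BoundedFormula.equal (Term.var (.inl a)) (Term.var (.inl b)), fun v => ?_⟩
  change _ ↔ s v = t v
  rw [← ha, ← hb]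
  rfl

theorem Dfn.forallFin [Finite β] {P : (α → V) → (β → V) → Prop}
    (h : Dfn C fun v : α ⊕ β → V => P (fun a => v (.inl a)) fun b => v (.inr b)) :
    Dfn C fun v => ∀ x, P v x := by
  obtain ⟨φ, h⟩ := h
  refine ⟨(φ.relabel (Equiv.sumAssoc C α β).symm).iAlls β, fun v => ?_⟩
  rw [Formula.realize_iAlls]
  refine forall_congr' fun x => ?_
  refine Iff.trans ?_ (h (Sum.elim v x))
  rw [Formula.realize_relabel, iff_iff_eq]
  congr 1
  ext (_ | _ | _) <;> rfl

theorem Dfn.existsFin [Finite β] {P : (α → V) → (β → V) → Prop}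
    (h : Dfn C fun v : α ⊕ β → V => P (fun a => v (.inl a)) fun b => v (.inr b)) :
    Dfn C fun v => ∃ x, P v x :=
  (Dfn.forallFin (P := fun v x => ¬ P v x) h.not).not.congr fun v => by push Not; rfl

theorem Dfn.all {P : (α → V) → V → Prop}
    (h : Dfn C fun v : α ⊕ Unit → V => P (fun a => v (.inl a)) (v (.inr ()))) :
    Dfn C fun v => ∀ x, P v x :=
  (Dfn.forallFin (P := fun v (x : Unit → V) => P v (x ())) h).congr fun _ =>
    ⟨fun h x => h fun _ => x, fun h _ => h _⟩

theorem Dfn.ex {P : (α → V) → V → Prop}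
    (h : Dfn C fun v : α ⊕ Unit → V => P (fun a => v (.inl a)) (v (.inr ()))) :
    Dfn C fun v => ∃ x, P v x :=
  (Dfn.all (P := fun v x => ¬ P v x) h.not).not.congr fun v => by push Not; rfl

/-- `∃!` unfolds to two copies of `P` under different numbers of quantifiers; each copy has its own
hypothesis. -/
theorem Dfn.exUnique {P : (α → V) → V → Prop}
    (h : Dfn C fun v : α ⊕ Unit → V => P (fun a => v (.inl a)) (v (.inr ())))
    (h' : Dfn C fun v : (α ⊕ Unit) ⊕ Unit → V =>
      P (fun a => v (.inl (.inl a))) (v (.inr ()))) :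
    Dfn C fun v => ∃! x, P v x :=
  .ex (h.and (.all (h'.imp (.eq (.proj _ _) (.proj _ _)))))

theorem Dfn.forallFinite {ι : Type} [Finite ι] {P : ι → (α → V) → Prop}
    (h : ∀ k, Dfn C (P k)) : Dfn C fun v => ∀ k, P k v := by
  choose φ h using h
  exact ⟨Formula.iInf φ, fun v => by simp [h]⟩

theorem Dfn.subst {P : (β → V) → Prop} (hP : Dfn C P) {t : β → (α → V) → V}
    (ht : ∀ b, IsVar C (t b)) : Dfn C fun v => P fun b => t b v := by
  obtain ⟨φ, h⟩ := hP
  choose a ha using ht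
  refine ⟨φ.relabel (Sum.elim .inl a), fun v => ?_⟩
  refine Iff.trans ?_ (h fun b => t b v)
  rw [Formula.realize_relabel, iff_iff_eq]
  congr 1
  ext (_ | b)
  · rfl
  · exact ha b v

theorem Dfn.subst₂ {Q : V → V → Prop} (hQ : Dfn C fun v : Fin 2 → V => Q (v 0) (v 1))
    (hs : IsVar C s) (ht : IsVar C t) : Dfn C fun v => Q (s v) (t v) :=
  hQ.subst (t := ![s, t]) fun b => by fin_cases b <;> assumption

theorem Dfn.mono {D : Set V} (hCD : C ⊆ D) (hP : Dfn C P) : Dfn D P := by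
  obtain ⟨φ, h⟩ := hP
  refine ⟨φ.relabel (Sum.map (Set.inclusion hCD) id), fun v => ?_⟩
  rw [Formula.realize_relabel, ← h, iff_iff_eq]
  congr 1
  ext (_ | b) <;> rfl

theorem Dfn.realize (C : Set V) (φ : memLang.Formula α) : Dfn C φ.Realize :=
  ⟨φ.relabel .inr, fun v => by rw [Formula.realize_relabel, Sum.elim_comp_inr]⟩

theorem Dfn.isPair (hs : IsVar C s) (ht : IsVar C t) (hu : IsVar C u) :
    Dfn C fun v => IsPair (s v) (t v) (u v) := by
  have : Dfn C fun v : Fin 3 → V => IsPair (v 0) (v 1) (v 2) :=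
    .all (.iff (.mem (.proj _ _) (.proj _ _)) (.or
      (.all (.iff (.mem (.proj _ _) (.proj _ _)) (.eq (.proj _ _) (.proj _ _))))
      (.all (.iff (.mem (.proj _ _) (.proj _ _))
        (.or (.eq (.proj _ _) (.proj _ _)) (.eq (.proj _ _) (.proj _ _)))))))
  exact this.subst (t := ![s, t, u]) fun b => by fin_cases b <;> assumption

theorem Dfn.val (hs : IsVar C s) (ht : IsVar C t) (hu : IsVar C u) :
    Dfn C fun v => Val (s v) (t v) (u v) := by
  have : Dfn C fun v : Fin 3 → V => Val (v 0) (v 1) (v 2) :=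
    .ex (.and (.mem (.proj _ _) (.proj _ _)) (.isPair (.proj _ _) (.proj _ _) (.proj _ _)))
  exact this.subst (t := ![s, t, u]) fun b => by fin_cases b <;> assumption

theorem Dfn.isFunOn (hs : IsVar C s) (ht : IsVar C t) :
    Dfn C fun v => IsFunOn (s v) (t v) := by
  have : Dfn C fun v : Fin 2 → V => IsFunOn (v 0) (v 1) :=
    .and (.all (.imp (.mem (.proj _ _) (.proj _ _)) (.ex (.and (.mem (.proj _ _) (.proj _ _))
      (.ex (.isPair (.proj _ _) (.proj _ _) (.proj _ _)))))))
    (.all (.imp (.mem (.proj _ _) (.proj _ _)) (.exUnique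
      (.val (.proj _ _) (.proj _ _) (.proj _ _)) (.val (.proj _ _) (.proj _ _) (.proj _ _)))))
  exact this.subst₂ hs ht

/-- A predicate definable from parameters in `C` is given by a formula in the format of the
axiom schemata. -/
theorem Dfn.exists_boundedFormula {P : V → Prop} (hP : Dfn C fun v : Unit → V => P (v ()))
    {c : V} (hc : c ∈ C) :
    ∃ (n : ℕ) (φ : memLang.BoundedFormula (Fin n) 1) (p : Fin n → V),
      (∀ k, p k ∈ C) ∧ ∀ x, φ.Realize p ![x] ↔ P x := by
  classical
  obtain ⟨φ, h⟩ := hP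
  let e := φ.freeVarFinset.equivFin
  let g : φ.freeVarFinset → Fin φ.freeVarFinset.card ⊕ Fin 1 := fun a =>
    Sum.elim (fun _ => .inl (e a)) (fun _ => .inr 0) a.1
  -- The object variable also occupies a slot of `p` if it is free in `φ`. That slot is never read,
  -- and `c` fills it so that all parameters lie in `C`.
  let p : Fin φ.freeVarFinset.card → V := fun k =>
    Sum.elim Subtype.val (fun _ => c) (e.symm k).1
  refine ⟨_, BoundedFormula.relabel (n := 1) g (φ.restrictFreeVar id), p, fun k => ?_,
    fun x => ?_⟩
  · change Sum.elim Subtype.val (fun _ => c) (e.symm k).1 ∈ C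
    cases (e.symm k).1 with
    | inl a => exact a.2
    | inr _ => exact hc
  · refine (BoundedFormula.realize_relabel (n := 0)).trans ?_
    refine Iff.trans ?_ (h fun _ => x)
    rw [Formula.Realize, Subsingleton.elim default (![x] ∘ Fin.natAdd 1)]
    refine BoundedFormula.realize_restrictFreeVar _ ?_
    rintro ⟨a | a, ha⟩
    · simp [g, p]
    · simp [g]

end Definability

/-! ### Pairs, products and choice functions in ZFC -/

section SetTheory

variable {V : Type*} [StMem V]

theorem ModelsZFC.exists_sep (hV : ModelsZFC V) {P : V → Prop}
    (hP : Dfn Set.univ fun v : Unit → V => P (v ())) (A : V) :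
    ∃ B, ∀ x, x ∊ B ↔ x ∊ A ∧ P x := by
  obtain ⟨n, φ, p, -, h⟩ := hP.exists_boundedFormula (Set.mem_univ A)
  obtain ⟨B, hB⟩ := hV.separation n φ p A
  exact ⟨B, fun x => by rw [hB, h]⟩

theorem ModelsZFC.exists_isPair (hV : ModelsZFC V) (a b : V) : ∃ z, IsPair z a b := by
  obtain ⟨p, hp⟩ := hV.pairing a a
  obtain ⟨q, hq⟩ := hV.pairing a b
  obtain ⟨z, hz⟩ := hV.pairing p q
  simp only [or_self] at hp
  refine ⟨z, fun u => (hz u).trans (or_congr ⟨?_, fun h => ?_⟩ ⟨?_, fun h => ?_⟩)⟩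
  · rintro rfl; exact hp
  · exact hV.extensionality _ _ fun v => (h v).trans (hp v).symm
  · rintro rfl; exact hq
  · exact hV.extensionality _ _ fun v => (h v).trans (hq v).symm

theorem IsPair.inj (hV : ModelsZFC V) {z a b a' b' : V} (h : IsPair z a b)
    (h' : IsPair z a' b') : a = a' ∧ b = b' := by
  obtain ⟨p, hp⟩ := hV.pairing a a
  obtain ⟨q, hq⟩ := hV.pairing a b
  obtain ⟨p', hp'⟩ := hV.pairing a' a'
  obtain ⟨q', hq'⟩ := hV.pairing a' b'
  have h1 := (h' p).1 ((h p).2 (.inl fun v => by simp [hp]))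
  have h2 := (h' q).1 ((h q).2 (.inr hq))
  have h3 := (h p').1 ((h' p').2 (.inl fun v => by simp [hp']))
  have h4 := (h q').1 ((h' q').2 (.inr hq'))
  simp only [hp, hq, hp', hq', or_self] at h1 h2 h3 h4
  have haa : a = a' := by
    rcases h1 with h1 | h1
    · exact (h1 a).1 rfl
    · exact ((h1 a').2 (.inl rfl)).symm
  subst haa
  refine ⟨rfl, ?_⟩
  -- Either {a, b} collapses to a singleton, forcing b = a, or it equals {a, b'}.
  rcases h2 with h2 | h2
  · have hb : b = a := (h2 b).1 (.inr rfl)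
    rcases h4 with h4 | h4
    · rw [hb, (h4 b').1 (.inr rfl)]
    · rcases (h4 b').1 (.inr rfl) with h | h
      · rw [hb, h]
      · exact h.symm
  · rcases (h2 b).1 (.inr rfl) with h | h
    · rcases (h2 b').2 (.inr rfl) with h' | h'
      · rw [h, h']
      · exact h'.symm
    · exact h

/-- Some set contains all pairs of elements of `I` and `A`. -/
theorem ModelsZFC.exists_prod (hV : ModelsZFC V) (I A : V) :
    ∃ W, ∀ i x z, i ∊ I → x ∊ A → IsPair z i x → z ∊ W := by
  -- `W` is the double power set of I ∪ A.
  obtain ⟨p, hp⟩ := hV.pairing I A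
  obtain ⟨J, hJ⟩ := hV.union p
  obtain ⟨K, hK⟩ := hV.powerset J
  obtain ⟨W, hW⟩ := hV.powerset K
  refine ⟨W, fun i x z hi hx hz => (hW z).2 fun u hu => (hK u).2 fun v hv => (hJ v).2 ?_⟩
  have : v = i ∨ v = x := by
    rcases (hz u).1 hu with h | h
    · exact .inl ((h v).1 hv)
    · exact (h v).1 hv
  rcases this with rfl | rfl
  · exact ⟨I, (hp I).2 (.inl rfl), hi⟩
  · exact ⟨A, (hp A).2 (.inr rfl), hx⟩

/-- A definable total relation between `I` and `A` contains a function on `I`. -/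
theorem ModelsZFC.exists_uniformization (hV : ModelsZFC V) {I A : V} {T : V → V → Prop}
    (hT : Dfn Set.univ fun v : Fin 2 → V => T (v 0) (v 1))
    (htot : ∀ i, i ∊ I → ∃ x, x ∊ A ∧ T i x) :
    ∃ g, IsFunOn g I ∧ ∀ i x, Val g i x → T i x := by
  have const {α : Type} (c : V) : IsVar Set.univ fun _ : α → V => c := .const (Set.mem_univ c)
  obtain ⟨W, hW⟩ := hV.exists_prod I A
  obtain ⟨R, hR⟩ := hV.exists_sep
    (P := fun z => ∃ i, i ∊ I ∧ ∃ x, x ∊ A ∧ IsPair z i x ∧ T i x)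
    (.ex (.and (.mem (.proj _ _) (const I)) (.ex (.and (.mem (.proj _ _) (const A))
      (.and (.isPair (.proj _ _) (.proj _ _) (.proj _ _))
        (hT.subst₂ (.proj _ _) (.proj _ _))))))) W
  obtain ⟨PR, hPR⟩ := hV.powerset R
  -- `F` is the family of fibres of `R` over points of `I`: nonempty by totality, and disjoint
  -- because a pair determines its first coordinate.
  obtain ⟨F, hF⟩ := hV.exists_sep
    (P := fun f => ∃ i, i ∊ I ∧ ∀ z, z ∊ f ↔ z ∊ R ∧ ∃ x, IsPair z i x)
    (.ex (.and (.mem (.proj _ _) (const I)) (.all (.iff (.mem (.proj _ _) (.proj _ _))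
      (.and (.mem (.proj _ _) (const R))
        (.ex (.isPair (.proj _ _) (.proj _ _) (.proj _ _)))))))) PR
  obtain ⟨K, hK⟩ := hV.choice F
    (fun f hf => by
      obtain ⟨-, i, hi, h⟩ := (hF f).1 hf
      obtain ⟨x, hx, hix⟩ := htot i hi
      obtain ⟨z, hz⟩ := hV.exists_isPair i x
      exact ⟨z, (h z).2 ⟨(hR z).2 ⟨hW i x z hi hx hz, i, hi, x, hx, hz, hix⟩, x, hz⟩⟩)
    (fun f f' hf hf' hne => by
      rintro ⟨z, hz, hz'⟩
      obtain ⟨-, i, -, h⟩ := (hF f).1 hf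
      obtain ⟨-, i', -, h'⟩ := (hF f').1 hf'
      obtain ⟨-, x, hx⟩ := (h z).1 hz
      obtain ⟨-, x', hx'⟩ := (h' z).1 hz'
      obtain ⟨rfl, -⟩ := hx.inj hV hx'
      exact hne (hV.extensionality _ _ fun z => (h z).trans (h' z).symm))
  -- The choice set may have elements outside the fibres, so it is cut down to `R`.
  obtain ⟨g, hg⟩ := hV.exists_sep (P := fun z => z ∊ K) (.mem (.proj _ _) (const K)) R
  refine ⟨g, ⟨fun z hz => ?_, fun i hi => ?_⟩, fun i x ⟨z, hz, hzix⟩ => ?_⟩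
  · obtain ⟨-, i, hi, x, -, hz, -⟩ := (hR z).1 ((hg z).1 hz).1
    exact ⟨i, hi, x, hz⟩
  · obtain ⟨f, hf⟩ := hV.exists_sep (P := fun z => ∃ x, IsPair z i x)
      (.ex (.isPair (.proj _ _) (const i) (.proj _ _))) R
    obtain ⟨z, ⟨hz, hzK⟩, huniq⟩ := hK f
      ((hF f).2 ⟨(hPR f).2 fun z hz => ((hf z).1 hz).1, i, hi, hf⟩)
    obtain ⟨hzR, x, hx⟩ := (hf z).1 hz
    refine ⟨x, ⟨z, (hg z).2 ⟨hzR, hzK⟩, hx⟩, ?_⟩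
    rintro y ⟨z', hz', hy⟩
    obtain ⟨hzR', hzK'⟩ := (hg z').1 hz'
    obtain rfl := huniq z' ⟨(hf z').2 ⟨hzR', y, hy⟩, hzK'⟩
    exact (hy.inj hV hx).2
  · obtain ⟨-, i', -, x', -, hz', h⟩ := (hR z).1 ((hg z).1 hz).1
    obtain ⟨rfl, rfl⟩ := hzix.inj hV hz'
    exact h

/-- Uniformization of a definable relation, with a default value where it has no value in `A`. -/
theorem ModelsZFC.exists_selector (hV : ModelsZFC V) (I : V) {A a : V} (ha : a ∊ A)
    {Q : V → V → Prop} (hQ : Dfn Set.univ fun v : Fin 2 → V => Q (v 0) (v 1)) :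
    ∃ g, IsFunOn g I ∧ ∀ i x y, x ∊ A → Q i x → Val g i y → Q i y := by
  have const {α : Type} (c : V) : IsVar Set.univ fun _ : α → V => c := .const (Set.mem_univ c)
  obtain ⟨g, hg, h⟩ := hV.exists_uniformization (I := I) (A := A)
    -- The implication makes the relation total: where `Q` has no solution in `A`, the value `a`
    -- qualifies vacuously.
    (T := fun i y => (∃ x, x ∊ A ∧ Q i x) → Q i y)
    (.imp (.ex (.and (.mem (.proj _ _) (const A)) (hQ.subst₂ (.proj _ _) (.proj _ _))))
      (hQ.subst₂ (.proj _ _) (.proj _ _)))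
    (fun i _ => by
      by_cases h : ∃ x, x ∊ A ∧ Q i x
      · obtain ⟨x, hx, hix⟩ := h
        exact ⟨x, hx, fun _ => hix⟩
      · exact ⟨a, ha, fun h' => (h h').elim⟩)
  exact ⟨g, hg, fun i x y hx hix hy => h i y hy ⟨x, hx, hix⟩⟩

end SetTheory

/-! ### Transfer, the set U_w and elementarity of the w-standard sets -/

section Standard

variable {V : Type*} [StMem V]

theorem ModelsBST.exists_st (hV : ModelsBST V) : ∃ c : V, St c := by
  obtain ⟨x, -⟩ := hV.infinity
  obtain ⟨y, hy, -⟩ := hV.boundedness x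
  exact ⟨y, hy⟩

theorem ModelsBST.forall_of_forall_st (hV : ModelsBST V) {P : V → Prop}
    (hP : Dfn {c | St c} fun v : Unit → V => P (v ())) (h : ∀ x, St x → P x) (x : V) : P x := by
  obtain ⟨c, hc⟩ := hV.exists_st
  obtain ⟨n, φ, p, hp, hφ⟩ := hP.exists_boundedFormula hc
  exact (hφ x).1 (hV.transfer n φ p hp (fun y hy => (hφ y).2 (h y hy)) x)

theorem ModelsBST.exists_st_of_exists (hV : ModelsBST V) {P : V → Prop}
    (hP : Dfn {c | St c} fun v : Unit → V => P (v ())) (h : ∃ x, P x) : ∃ x, St x ∧ P x := by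
  by_contra! h'
  obtain ⟨x, hx⟩ := h
  exact hV.forall_of_forall_st hP.not h' x hx

theorem ModelsBST.st_ext (hV : ModelsBST V) {X Y : V} (hX : St X) (hY : St Y)
    (h : ∀ z, St z → (z ∊ X ↔ z ∊ Y)) : X = Y :=
  hV.extensionality X Y <| hV.forall_of_forall_st
    (.iff (.mem (.proj _ _) (.const hX)) (.mem (.proj _ _) (.const hY))) h

/-- Standardization, which admits the possibly nonstandard parameter `w`, is applied inside the
power set of `I`. Uniqueness is extensionality plus Transfer. -/
theorem ModelsBST.existsUnique_isUW (hV : ModelsBST V) (w I : V) : ∃! U, IsUW w I U := by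
  obtain ⟨K, hK⟩ := hV.powerset I
  obtain ⟨U, hU, h⟩ := hV.standardization 1
    (BoundedFormula.rel StMemRel.mem ![Term.var (.inl 0), Term.var (.inr 0)]) ![w] K
  refine ⟨U, ⟨hU, fun X hX => (h X hX).trans (and_congr (hK X) Iff.rfl)⟩, ?_⟩
  rintro U' ⟨hU', h'⟩
  exact hV.st_ext hU' hU fun X hX =>
    (h' X hX).trans ((h X hX).trans (and_congr (hK X) Iff.rfl)).symm

/-- A relation definable from standard parameters has a `w`-standard value at `w` if it has one
at all. -/
theorem ModelsBST.exists_stW (hV : ModelsBST V) {w I : V} (hI : St I) (hw : w ∊ I)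
    {Q : V → V → Prop} (hQ : Dfn {c | St c} fun v : Fin 2 → V => Q (v 0) (v 1))
    (h : ∃ x, Q w x) : ∃ x, StW w I x ∧ Q w x := by
  obtain ⟨a, ha⟩ := h
  obtain ⟨A, hA, haA⟩ := hV.boundedness a
  -- Transfer applies because `w` does not occur here: the parameters are `I`, `A` and those of `Q`.
  obtain ⟨g, hg, hgI, h⟩ := hV.exists_st_of_exists
    (P := fun g => IsFunOn g I ∧ ∀ i x y, x ∊ A → Q i x → Val g i y → Q i y)
    (.and (.isFunOn (.proj _ _) (.const hI)) (.all (.all (.all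
      (.imp (.mem (.proj _ _) (.const hA)) (.imp (hQ.subst₂ (.proj _ _) (.proj _ _))
        (.imp (.val (.proj _ _) (.proj _ _) (.proj _ _))
          (hQ.subst₂ (.proj _ _) (.proj _ _)))))))))
    (hV.exists_selector I haA (hQ.mono (Set.subset_univ _)))
  obtain ⟨y, hy, -⟩ := hgI.2 w hw
  exact ⟨y, ⟨g, hg, hgI, hy⟩, h w a y haA ha hy⟩

/-- The `w`-standard sets pass the Tarski–Vaught test. -/
theorem ModelsBST.exists_stW_realize (hV : ModelsBST V) {w I : V} (hI : St I) (hw : w ∊ I)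
    {α : Type} [Finite α] (φ : memLang.Formula (α ⊕ Unit)) (y : α → V)
    (hy : ∀ a, StW w I (y a)) (h : ∃ x, φ.Realize (Sum.elim y fun _ => x)) :
    ∃ x, StW w I x ∧ φ.Realize (Sum.elim y fun _ => x) := by
  choose f hf hfI hfy using hy
  have hyu (y' : α → V) (h : ∀ a, Val (f a) w (y' a)) : y' = y :=
    funext fun a => ((hfI a).2 w hw).unique (h a) (hfy a)
  obtain ⟨x, hx, y', hy', h'⟩ := hV.exists_stW hI hw
    -- The parameters `y a` need not be standard; writing them as values of the standard `f a` at a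
    -- variable point `i` leaves only standard parameters.
    (Q := fun i x => ∃ y : α → V, (∀ a, Val (f a) i (y a)) ∧ φ.Realize (Sum.elim y fun _ => x))
    (.existsFin (.and
      (.forallFinite fun a => .val (.const (hf a)) (.proj _ _) (.proj _ _))
      (((Dfn.realize _ φ).subst
        (t := Sum.elim (fun a v => v (.inr a)) fun _ v => v (.inl 1)) (by
          rintro (a | a)
          · exact .proj _ _
          · exact .proj _ _)).congr fun v => by
            rw [iff_iff_eq]
            congr 1
            ext (_ | _) <;> rfl)))
    (h.imp fun x hx => ⟨y, hfy, hx⟩)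
  obtain rfl := hyu y' hy'
  exact ⟨x, hx, h'⟩

/-- The `w`-standard sets form an elementary submodel of the universe. -/
theorem ModelsBST.relRealize_stW_iff (hV : ModelsBST V) {w I : V} (hI : St I) (hw : w ∊ I)
    {r n : ℕ} (φ : memLang.BoundedFormula (Fin r) n) (v : Fin r → V) (hv : ∀ k, StW w I (v k))
    (xs : Fin n → V) (hxs : ∀ k, StW w I (xs k)) :
    RelRealize (StW w I) φ v xs ↔ φ.Realize v xs := by
  induction φ with
  | falsum => rfl
  | equal => rfl
  | rel => rfl
  | imp φ ψ ih ih' => exact imp_congr (ih xs hxs) (ih' xs hxs)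
  | @all n φ ih =>
    have key : (∀ x, StW w I x → φ.Realize v (Fin.snoc xs x)) ↔
        ∀ x, φ.Realize v (Fin.snoc xs x) := by
      refine ⟨fun h => ?_, fun h x _ => h x⟩
      by_contra! hex
      -- Only the last bound variable, the one being quantified, is singled out as the unknown; all
      -- others become parameters.
      let e : Fin r ⊕ Fin (n + 1) → (Fin r ⊕ Fin n) ⊕ Unit :=
        Sum.elim (fun k => .inl (.inl k)) (Fin.snoc (α := fun _ => (Fin r ⊕ Fin n) ⊕ Unit)
          (fun k => .inl (.inr k)) (.inr ()))
      have he (x : V) : (Formula.relabel e φ.not.toFormula).Realize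
          (Sum.elim (Sum.elim v xs) fun _ => x) ↔ ¬ φ.Realize v (Fin.snoc xs x) := by
        rw [Formula.realize_relabel, BoundedFormula.realize_toFormula,
          BoundedFormula.realize_not, not_iff_not, iff_iff_eq]
        congr 1
        ext k
        refine Fin.lastCases ?_ (fun k => ?_) k <;> simp [e]
      obtain ⟨x, hx, hx'⟩ := hV.exists_stW_realize hI hw (Formula.relabel e φ.not.toFormula)
        (Sum.elim v xs) (by rintro (k | k); exacts [hv k, hxs k]) (hex.imp fun x => (he x).2)
      exact (he x).1 hx' (h x hx)
    refine Iff.trans (forall₂_congr fun x hx => ih (Fin.snoc xs x) fun k => ?_) key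
    refine Fin.lastCases ?_ (fun k => ?_) k
    · simpa using hx
    · simpa using hxs k

end Standard

end BST

theorem mainTheorem6 {V : Type*} [BST.StMem V] (hV : BST.ModelsBST V)
    (w I : V) (hI : BST.St I) (hw : w ∊ I) :
    (∃! U, BST.IsUW w I U) ∧
    ∀ U, BST.IsUW w I U →
      ∀ (r : ℕ) (φ : BST.memLang.Formula (Fin r)) (f : Fin r → V),
        (∀ k, BST.St (f k)) → (∀ k, BST.IsFunOn (f k) I) →
        ((∃ x : Fin r → V, (∀ k, BST.Val (f k) w (x k)) ∧
            BST.RelRealize (BST.StW w I) φ x default) ↔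
          ∃ X, (∀ i, i ∊ X ↔ i ∊ I ∧
              ∃ x : Fin r → V, (∀ k, BST.Val (f k) i (x k)) ∧ φ.Realize x) ∧
            X ∊ U) := by
  refine ⟨hV.existsUnique_isUW w I, fun U hU r φ f hf hfI => ?_⟩
  -- `C` is left general to serve both Transfer (standard parameters) and Separation (all
  -- parameters).
  have hΦ {α : Type} {C : Set V} (hC : {c | BST.St c} ⊆ C) (a : α) : BST.Dfn C fun v : α → V =>
      v a ∊ I ∧ ∃ x : Fin r → V, (∀ k, BST.Val (f k) (v a) (x k)) ∧ φ.Realize x :=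
    .and (.mem (.proj _ _) (.const (hC hI))) (.existsFin (.and
      (.forallFinite fun k => .val (.const (hC (hf k))) (.proj _ _) (.proj _ _))
      ((BST.Dfn.realize _ φ).subst fun _ => .proj _ _)))
  obtain ⟨X, hX, hXI⟩ := hV.exists_st_of_exists
    (P := fun X => ∀ i, i ∊ X ↔ i ∊ I ∧
      ∃ x : Fin r → V, (∀ k, BST.Val (f k) i (x k)) ∧ φ.Realize x)
    (.all (.iff (.mem (.proj _ _) (.proj _ _)) (hΦ subset_rfl _)))
    (by
      obtain ⟨X, hX⟩ := hV.exists_sep (P := fun i => i ∊ I ∧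
        ∃ x : Fin r → V, (∀ k, BST.Val (f k) i (x k)) ∧ φ.Realize x) (hΦ (Set.subset_univ _) ()) I
      exact ⟨X, fun i => by rw [hX]; tauto⟩)
  have hXU : X ∊ U ↔ ∃ x : Fin r → V, (∀ k, BST.Val (f k) w (x k)) ∧ φ.Realize x := by
    rw [hU.2 X hX, hXI w]
    exact ⟨fun h => h.2.2, fun h => ⟨fun i hi => ((hXI i).1 hi).1, hw, h⟩⟩
  have hrel (x : Fin r → V) (hx : ∀ k, BST.Val (f k) w (x k)) :
      BST.RelRealize (BST.StW w I) φ x default ↔ φ.Realize x :=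
    hV.relRealize_stW_iff hI hw φ x (fun k => ⟨f k, hf k, hfI k, hx k⟩) default nofun
  refine Iff.trans ?_ (hXU.symm.trans ⟨fun h => ⟨X, hXI, h⟩, fun ⟨Y, hY, hYU⟩ => ?_⟩)
  · exact exists_congr fun x => and_congr_right (hrel x)
  · rwa [hV.extensionality X Y fun i => (hXI i).trans (hY i).symm]
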